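/- Let $n\ge 2$ be an integer and $\sigma>0$ a real number. For $\theta>-3/2$ the power semicircle law $PS(\theta,\sigma)$ is the beta distribution with parameters $p=q=\theta+\tfrac32$ on $(-\sigma,\sigma)$, i.e. the probability measure on $\mathbb R$ with density $$\frac{(x+\sigma)^{\theta+1/2}(\sigma-x)^{\theta+1/2}}{B(\theta+\frac32,\theta+\frac32)\,(2\sigma)^{2\theta+2}}\quad(-\sigma<x<\sigma),$$ and density $0$ elsewhere, where $B(p,q)=\Gamma(p)\Gamma(q)/\Gamma(p+q)$; $PS(-1,\sigma)$ is the arcsine law on $(-\sigma,\sigma)$. Let $U_1,\dots,U_{n-1}$ be uniformly distributed on $(0,1)$ and let $X_1,\dots,X_n$ be real random variables with continuous distribution functions, all these $2n-1$ random variables being mutually independent. Let $U_{(1)}\le\dots\le U_{(n-1)}$ be the order statistics of $U_1,\dots,U_{n-1}$, put $U_{(0)}=0$ and $U_{(n)}=1$, and let $R_i=U_{(i)}-U_{(i-1)}$ for $1\le i\le n$. The random variable $S_n=\sum_{i=1}^n R_iX_i$ is called the randomly weighted average (RWA) of $X_1,\dots,X_n$. Then $PS\left(\frac{n-3}{2},\sigma\right)$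 is the distribution of an RWA $S_n$. More precisely, there is a probability space carrying such random variables in which every $X_i$ has the arcsine law on $(-\sigma,\sigma)$ and $S_n$ has the distribution $PS\left(\frac{n-3}{2},\sigma\right)$; and, on any probability space, whenever $U_1,\dots,U_{n-1},X_1,\dots,X_n$ are as above and every $X_i$ has the arcsine law on $(-\sigma,\sigma)$, the RWA $S_n$ has the distribution $PS\left(\frac{n-3}{2},\sigma\right)$. -/

import Mathlib

open MeasureTheory ProbabilityTheory

namespace RandomWeightedAverage

/-- The density of the beta distribution with parameters `p`, `q` on the interval `(a, b)`
(meaningful for `p, q > 0` and `a < b`); `ProbabilityTheory.beta p q` is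
`Γ(p) Γ(q) / Γ(p + q)`. -/
noncomputable def betaDensityOn (p q a b x : ℝ) : ℝ :=
  if a < x ∧ x < b then
    1 / (beta p q * (b - a) ^ (p + q - 1)) * (x - a) ^ (p - 1) * (b - x) ^ (q - 1)
  else 0

/-- The beta distribution with parameters `p`, `q` on the interval `(a, b)`. -/
noncomputable def betaLawOn (p q a b : ℝ) : Measure ℝ :=
  volume.withDensity fun x => ENNReal.ofReal (betaDensityOn p q a b x)

/-- The power semicircle distribution `PS(θ, σ)` on `(-σ, σ)`
(meaningful for `θ > -3/2` and `σ > 0`). -/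
noncomputable def powerSemicircle (θ σ : ℝ) : Measure ℝ :=
  betaLawOn (θ + 3 / 2) (θ + 3 / 2) (-σ) σ

/-- The arcsine distribution on `(-σ, σ)`, that is, `PS(-1, σ)`, the symmetric beta distribution
with both parameters `1/2`; its density is `1 / (π √(σ² - x²))` for `-σ < x < σ`. -/
noncomputable def arcsineLaw (σ : ℝ) : Measure ℝ :=
  powerSemicircle (-1) σ

/-- The order statistics `u₍₁₎ ≤ … ≤ u₍ₘ₎` of a sample `u` of size `m`, extended by the conventions
`u₍₀₎ = 0` and `u₍ₘ₊₁₎ = 1`. The order statistics proper are the values of `u` listed in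
increasing order. -/
noncomputable def orderStatistic {m : ℕ} (u : Fin m → ℝ) (i : ℕ) : ℝ :=
  if i = 0 then 0
  else if h : i - 1 < m then u (Tuple.sort u ⟨i - 1, h⟩)
  else 1

/-- The `i`-th of the `n` spacings of a sample of size `n - 1`, where `i` is counted from `0`:
`R_{i+1} = u₍ᵢ₊₁₎ - u₍ᵢ₎`. -/
noncomputable def spacing {n : ℕ} (u : Fin (n - 1) → ℝ) (i : Fin n) : ℝ :=
  orderStatistic u (i + 1) - orderStatistic u i

/-- The randomly weighted average `S_n = R₁ X₁ + ⋯ + R_n X_n`, whose weights are the spacings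
of the sample `U`. -/
noncomputable def rwa {Ω : Type*} {n : ℕ} (U : Fin (n - 1) → Ω → ℝ) (X : Fin n → Ω → ℝ)
    (ω : Ω) : ℝ :=
  ∑ i, spacing (fun j => U j ω) i * X i ω

/-- The data of a randomly weighted average: a random sample `U` of size `n - 1` from the uniform
distribution on `(0, 1)` and `n` continuous random variables `X` (that is, with continuous
distribution functions, or laws without atoms), all of these being mutually independent. -/
structure IsRWAData {Ω : Type*} [MeasurableSpace Ω] {n : ℕ}
    (U : Fin (n - 1) → Ω → ℝ) (X : Fin n → Ω → ℝ) (P : Measure Ω) : Prop where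
  uniform : ∀ j, pdf.IsUniform (U j) (Set.Ioo 0 1) P volume
  aemeasurable : ∀ i, AEMeasurable (X i) P
  continuous_law : ∀ i x, P.map (X i) {x} = 0
  indep : iIndepFun (Sum.elim U X) P

end RandomWeightedAverage

namespace RandomWeightedAverage

/-! The proof compares moments. Put `m = n - 1`. Since the spacings sum to one, everything can be
shifted by `σ`, so that the variables take values in `(0, 2σ)`; nonnegativity then lets the moments
be computed in `ENNReal` without integrability conditions. For fixed `x ≥ 0`, the `k`-th moment of
the spacing-weighted average over the uniform sample is `k! m! / (m + k)! · h_k(x)`, with `h_k` the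
complete homogeneous symmetric polynomial (`setLIntegral_spacingAverage_pow`). This is an induction
on `m` that conditions on the largest sample point. Because `∑ h_k(x) z^k = ∏ 1 / (1 - x_i z)`,
independence makes `E h_k(X)` the `z^k`-coefficient of the `n`-th power of the series of moments of
one `X_i` (`lintegral_completeHomogeneous`). For the shifted arcsine law that series is `(1 -
2σz)^(-1/2)`, so its `n`-th power is `(1 - 2σz)^(-n/2)` (`coeff_pow_mk_multichoose`). The beta law
with both parameters `n/2` has moments equal to these coefficients times the same factor `k! m! / (m
+ k)!` (`beta_div_beta`). On a compact interval moments determine the law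
(`ext_of_lintegral_pow_eq`). -/

/-! ### Order statistics and spacings -/

theorem orderStatistic_zero {m : ℕ} (u : Fin m → ℝ) : orderStatistic u 0 = 0 := by
  simp [orderStatistic]

theorem orderStatistic_succ {m : ℕ} (u : Fin m → ℝ) (i : Fin m) :
    orderStatistic u (i + 1) = u (Tuple.sort u i) := by
  simp [orderStatistic]

theorem orderStatistic_last {m : ℕ} (u : Fin m → ℝ) : orderStatistic u (m + 1) = 1 := by
  simp [orderStatistic]

/-- Sorting permutations may differ on ties, but the sorted list is the same, so any convenient one
computes the order statistics. -/
theorem orderStatistic_eq_of_monotone {m : ℕ} {u : Fin m → ℝ} {τ : Equiv.Perm (Fin m)}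
    (h : Monotone (u ∘ τ)) (i : Fin m) : orderStatistic u (i + 1) = u (τ i) := by
  rw [orderStatistic_succ]
  exact congrFun (Tuple.comp_sort_eq_comp_iff_monotone.2 h).symm i

theorem orderStatistic_smul {m : ℕ} (v : Fin m → ℝ) {s : ℝ} (hs : 0 ≤ s) (i : Fin m) :
    orderStatistic (s • v) (i + 1) = s * orderStatistic v (i + 1) := by
  rw [orderStatistic_succ v, orderStatistic_eq_of_monotone (τ := Tuple.sort v)]
  · simp
  · intro a b hab
    exact mul_le_mul_of_nonneg_left (Tuple.monotone_sort v hab) hs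

/-- The permutation that lists `p` last and the other indices in the order given by `τ`. -/
def insertLastPerm {m : ℕ} (p : Fin (m + 1)) (τ : Equiv.Perm (Fin m)) :
    Equiv.Perm (Fin (m + 1)) :=
  (finSuccEquiv' (Fin.last m)).trans
    ((Equiv.optionCongr τ).trans (finSuccEquiv' p).symm)

theorem insertLastPerm_last {m : ℕ} (p : Fin (m + 1)) (τ : Equiv.Perm (Fin m)) :
    insertLastPerm p τ (Fin.last m) = p := by
  simp [insertLastPerm]

theorem insertLastPerm_castSucc {m : ℕ} (p : Fin (m + 1)) (τ : Equiv.Perm (Fin m)) (i : Fin m) :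
    insertLastPerm p τ i.castSucc = p.succAbove (τ i) := by
  simp [insertLastPerm, finSuccEquiv'_last_apply_castSucc]

theorem monotone_insertNth_comp {m : ℕ} (p : Fin (m + 1)) {s : ℝ} {v : Fin m → ℝ}
    (h : ∀ j, v j ≤ s) :
    Monotone ((p.insertNth s v : Fin (m + 1) → ℝ) ∘ insertLastPerm p (Tuple.sort v)) := by
  intro a b hab
  induction b using Fin.lastCases with
  | last =>
    induction a using Fin.lastCases with
    | last => exact le_rfl
    | cast a => simpa [insertLastPerm_last, insertLastPerm_castSucc] using h _
  | cast b =>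
    induction a using Fin.lastCases with
    | last => exact absurd hab (not_le.2 (Fin.castSucc_lt_last b))
    | cast a =>
      simpa [insertLastPerm_castSucc] using
        Tuple.monotone_sort v (Fin.castSucc_le_castSucc_iff.1 hab)

theorem orderStatistic_insertNth {m : ℕ} (p : Fin (m + 1)) {s : ℝ} {v : Fin m → ℝ}
    (h : ∀ j, v j ≤ s) (i : Fin m) :
    orderStatistic (p.insertNth s v : Fin (m + 1) → ℝ) (i + 1) = orderStatistic v (i + 1) := by
  have := orderStatistic_eq_of_monotone (monotone_insertNth_comp p h) i.castSucc
  simpa [insertLastPerm_castSucc, orderStatistic_succ] using this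

theorem orderStatistic_insertNth_last {m : ℕ} (p : Fin (m + 1)) {s : ℝ} {v : Fin m → ℝ}
    (h : ∀ j, v j ≤ s) :
    orderStatistic (p.insertNth s v : Fin (m + 1) → ℝ) (m + 1) = s := by
  have := orderStatistic_eq_of_monotone (monotone_insertNth_comp p h) (Fin.last m)
  simpa [insertLastPerm_last] using this

/-- The convention that the order statistic of index `m + 1` of `v` is `1` absorbs the case of the
new maximum `s = s * 1`. -/
theorem orderStatistic_insertNth_smul {m : ℕ} (p : Fin (m + 1)) {s : ℝ} (hs : 0 ≤ s)
    {v : Fin m → ℝ} (hv : ∀ j, v j ≤ 1) {i : ℕ} (hi : i ≤ m + 1) :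
    orderStatistic (p.insertNth s (s • v) : Fin (m + 1) → ℝ) i = s * orderStatistic v i := by
  have h : ∀ j, (s • v) j ≤ s := fun j => by
    simpa using mul_le_mul_of_nonneg_left (hv j) hs
  obtain rfl | ⟨i, rfl⟩ : i = 0 ∨ ∃ k, i = k + 1 := by
    cases i <;> simp
  · simp [orderStatistic_zero]
  · obtain hlt | rfl : i < m ∨ i = m := by omega
    · rw [← orderStatistic_smul v hs ⟨i, hlt⟩]
      exact orderStatistic_insertNth p h ⟨i, hlt⟩
    · rw [orderStatistic_last, mul_one, orderStatistic_insertNth_last p h]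

/-- The average of `x` with weights the spacings of `u`. -/
noncomputable def spacingAverage {m : ℕ} (u : Fin m → ℝ) (x : Fin (m + 1) → ℝ) : ℝ :=
  ∑ i : Fin (m + 1), (orderStatistic u (i + 1) - orderStatistic u i) * x i

/-- The recursion behind the induction: below the maximum `s` the spacings are those of `v` scaled
by `s`, and the last spacing is `1 - s`. The position `p` of the maximum plays no role. -/
theorem spacingAverage_insertNth_smul {m : ℕ} (p : Fin (m + 1)) {s : ℝ} (hs : 0 ≤ s)
    {v : Fin m → ℝ} (hv : ∀ j, v j ≤ 1) (x : Fin (m + 2) → ℝ) :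
    spacingAverage (p.insertNth s (s • v) : Fin (m + 1) → ℝ) x =
      s * spacingAverage v (fun i => x i.castSucc) + (1 - s) * x (Fin.last (m + 1)) := by
  rw [spacingAverage, Fin.sum_univ_castSucc, spacingAverage, Finset.mul_sum]
  congr 1
  · refine Finset.sum_congr rfl fun i _ => ?_
    rw [Fin.val_castSucc, orderStatistic_insertNth_smul p hs hv (by omega),
      orderStatistic_insertNth_smul p hs hv (by omega)]
    ring
  · rw [Fin.val_last, orderStatistic_last, orderStatistic_insertNth_smul p hs hv le_rfl,
      orderStatistic_last, mul_one]

theorem sum_spacing {m : ℕ} (u : Fin m → ℝ) :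
    ∑ i : Fin (m + 1), (orderStatistic u (i + 1) - orderStatistic u i) = 1 := by
  rw [Fin.sum_univ_eq_sum_range (fun i => orderStatistic u (i + 1) - orderStatistic u i),
    Finset.sum_range_sub, orderStatistic_last, orderStatistic_zero, sub_zero]

theorem spacing_nonneg {m : ℕ} {u : Fin m → ℝ} (h0 : ∀ j, 0 ≤ u j) (h1 : ∀ j, u j ≤ 1)
    (i : Fin (m + 1)) : 0 ≤ orderStatistic u (i + 1) - orderStatistic u i := by
  obtain ⟨i, hi⟩ := i
  rw [sub_nonneg]
  change orderStatistic u i ≤ orderStatistic u (i + 1)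
  obtain hlt | rfl : i < m ∨ i = m := by omega
  · rw [orderStatistic_succ u ⟨i, hlt⟩]
    cases i with
    | zero => rw [orderStatistic_zero]; exact h0 _
    | succ i =>
      rw [orderStatistic_succ u ⟨i, by omega⟩]
      exact Tuple.monotone_sort u (Fin.mk_le_mk.2 (Nat.le_succ i))
  · rw [orderStatistic_last]
    cases i with
    | zero => rw [orderStatistic_zero]; exact zero_le_one
    | succ i => rw [orderStatistic_succ u ⟨i, by omega⟩]; exact h1 _

theorem spacingAverage_add_const {m : ℕ} (u : Fin m → ℝ) (x : Fin (m + 1) → ℝ) (c : ℝ) :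
    spacingAverage u (fun i => x i + c) = spacingAverage u x + c := by
  simp only [spacingAverage, mul_add, Finset.sum_add_distrib, ← Finset.sum_mul, sum_spacing,
    one_mul]

theorem spacingAverage_nonneg {m : ℕ} {u : Fin m → ℝ} (h0 : ∀ j, 0 ≤ u j) (h1 : ∀ j, u j ≤ 1)
    {x : Fin (m + 1) → ℝ} (hx : ∀ i, 0 ≤ x i) : 0 ≤ spacingAverage u x :=
  Finset.sum_nonneg fun i _ => mul_nonneg (spacing_nonneg h0 h1 i) (hx i)

theorem spacingAverage_mem_Icc {m : ℕ} {u : Fin m → ℝ} (h0 : ∀ j, 0 ≤ u j) (h1 : ∀ j, u j ≤ 1)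
    {x : Fin (m + 1) → ℝ} {a b : ℝ} (hx : ∀ i, x i ∈ Set.Icc a b) :
    spacingAverage u x ∈ Set.Icc a b :=
  (convex_Icc a b).sum_mem (fun i _ => spacing_nonneg h0 h1 i) (sum_spacing u) fun i _ => hx i

theorem measurable_orderStatistic {m : ℕ} (i : ℕ) :
    Measurable fun u : Fin m → ℝ => orderStatistic u i := by
  unfold orderStatistic
  split_ifs with h h'
  · exact measurable_const
  -- `Tuple.sort` breaks ties by index, so each set on which it is constant is cut out by finitely
  -- many coordinate comparisons; the order statistic is a coordinate on each of these pieces.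
  · have hs : ∀ τ : Equiv.Perm (Fin m), MeasurableSet {u : Fin m → ℝ | Tuple.sort u = τ} := by
      intro τ
      have : {u : Fin m → ℝ | Tuple.sort u = τ} =
          {u | (∀ i j, i ≤ j → u (τ i) ≤ u (τ j)) ∧
            ∀ i j, i < j → u (τ i) = u (τ j) → τ i < τ j} := by
        ext u
        rw [Set.mem_ofPred_eq, eq_comm, Tuple.eq_sort_iff]
        rfl
      rw [this]
      simp only [measurableSet_setOfPred]
      fun_prop
    have hsum : (fun u : Fin m → ℝ => u (Tuple.sort u ⟨i - 1, h'⟩)) = fun u =>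
        ∑ τ : Equiv.Perm (Fin m),
          Set.indicator {u : Fin m → ℝ | Tuple.sort u = τ} (fun u => u (τ ⟨i - 1, h'⟩)) u := by
      ext u
      simp [Set.indicator_apply]
    rw [hsum]
    exact Finset.measurable_fun_sum _ fun τ _ => (measurable_pi_apply _).indicator (hs τ)
  · exact measurable_const

theorem measurable_spacingAverage {m : ℕ} :
    Measurable fun q : (Fin m → ℝ) × (Fin (m + 1) → ℝ) => spacingAverage q.1 q.2 := by
  unfold spacingAverage
  refine Finset.measurable_fun_sum _ fun i _ => ?_
  have h : ∀ k, Measurable fun q : (Fin m → ℝ) × (Fin (m + 1) → ℝ) => orderStatistic q.1 k :=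
    fun k => (measurable_orderStatistic k).comp measurable_fst
  exact ((h _).sub (h _)).mul ((measurable_pi_apply i).comp measurable_snd)

/-! ### Integration over the cube by conditioning on the maximum -/

/-- The open unit cube. -/
def unitCube (m : ℕ) : Set (Fin m → ℝ) := Set.univ.pi fun _ => Set.Ioo 0 1

theorem measurableSet_unitCube (m : ℕ) : MeasurableSet (unitCube m) :=
  MeasurableSet.univ_pi fun _ => measurableSet_Ioo

/-- The points of the open unit cube whose strictly largest coordinate is the `p`-th. -/
def maxRegion {m : ℕ} (p : Fin (m + 1)) : Set (Fin (m + 1) → ℝ) :=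
  {u | u p ∈ Set.Ioo 0 1 ∧ ∀ j, u (p.succAbove j) ∈ Set.Ioo 0 (u p)}

theorem measurableSet_maxRegion {m : ℕ} (p : Fin (m + 1)) : MeasurableSet (maxRegion p) := by
  unfold maxRegion
  simp only [Set.mem_Ioo, measurableSet_setOfPred]
  fun_prop

theorem lt_of_mem_maxRegion {m : ℕ} {p j : Fin (m + 1)} {u : Fin (m + 1) → ℝ}
    (hu : u ∈ maxRegion p) (hj : j ≠ p) : u j < u p := by
  obtain ⟨k, rfl⟩ := Fin.exists_succAbove_eq hj
  exact (hu.2 k).2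

theorem pairwise_disjoint_maxRegion {m : ℕ} :
    Pairwise (Function.onFun Disjoint (maxRegion (m := m))) := by
  intro p q hpq
  refine Set.disjoint_left.2 fun u hp hq => ?_
  exact lt_asymm (lt_of_mem_maxRegion hp hpq.symm) (lt_of_mem_maxRegion hq hpq)

theorem volume_eq_coord {ι : Type*} [Fintype ι] {i j : ι} (hij : i ≠ j) :
    volume {u : ι → ℝ | u i = u j} = 0 := by
  classical
  let f : (ι → ℝ) →ₗ[ℝ] ℝ :=
    LinearMap.proj (R := ℝ) (φ := fun _ => ℝ) i - LinearMap.proj j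
  have h := Measure.addHaar_submodule (volume : Measure (ι → ℝ)) (LinearMap.ker f) (by
    intro htop
    have : Pi.single i (1 : ℝ) ∈ LinearMap.ker f := htop ▸ Submodule.mem_top
    simp [f, Pi.single_eq_of_ne hij.symm] at this)
  convert! h using 2
  ext u
  simp [f, sub_eq_zero]

/-- Away from the null set of ties, exactly one coordinate is the largest. -/
theorem unitCube_ae_eq_iUnion_maxRegion (m : ℕ) :
    unitCube (m + 1) =ᵐ[volume] ⋃ p, maxRegion (m := m) p := by
  have hne : ∀ᵐ u : Fin (m + 1) → ℝ, ∀ i j, i ≠ j → u i ≠ u j := by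
    rw [ae_all_iff]; intro i
    rw [ae_all_iff]; intro j
    by_cases hij : i = j
    · simp [hij]
    · filter_upwards [measure_eq_zero_iff_ae_notMem.1 (volume_eq_coord hij)] with u hu _
      exact hu
  filter_upwards [hne] with u hu
  refine propext (?_ : u ∈ unitCube (m + 1) ↔ u ∈ ⋃ p, maxRegion p)
  rw [Set.mem_iUnion]
  constructor
  · intro h
    obtain ⟨p, -, hp⟩ := Finset.exists_max_image Finset.univ u Finset.univ_nonempty
    refine ⟨p, h p trivial, fun j => ⟨(h _ trivial).1, ?_⟩⟩
    exact lt_of_le_of_ne (hp _ (Finset.mem_univ _)) (hu _ _ (Fin.succAbove_ne p j))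
  · rintro ⟨p, hp⟩ j -
    by_cases hj : j = p
    · rw [hj]; exact hp.1
    · obtain ⟨k, rfl⟩ := Fin.exists_succAbove_eq hj
      exact ⟨(hp.2 k).1, (hp.2 k).2.trans hp.1.2⟩

theorem setLIntegral_cube_scale {m : ℕ} {s : ℝ} (hs : 0 < s) {g : (Fin m → ℝ) → ENNReal}
    (hg : Measurable g) :
    ∫⁻ v in Set.univ.pi fun _ => Set.Ioo 0 s, g v =
      ENNReal.ofReal (s ^ m) * ∫⁻ v in unitCube m, g (s • v) := by
  have hpre : (fun v : Fin m → ℝ => s • v) ⁻¹' (Set.univ.pi fun _ => Set.Ioo 0 s) =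
      unitCube m := by
    ext v
    simp [unitCube, Set.mem_pi, hs, mul_lt_iff_lt_one_right hs]
  have hmeas : MeasurableSet (Set.univ.pi fun _ : Fin m => Set.Ioo 0 s) :=
    MeasurableSet.univ_pi fun _ => measurableSet_Ioo
  rw [← hpre, ← setLIntegral_map hmeas hg (measurable_const_smul s),
    Measure.map_addHaar_smul _ hs.ne', Measure.restrict_smul, lintegral_smul_measure,
    Module.finrank_fin_fun, abs_of_pos (by positivity), smul_eq_mul, ← mul_assoc,
    ← ENNReal.ofReal_mul (by positivity), mul_inv_cancel₀ (by positivity), ENNReal.ofReal_one,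
    one_mul]

/-- Fubini with the maximum `s` as outer variable: the other coordinates range over `(0, s)^m`, and
rescaling that cube to the unit cube contributes the Jacobian `s ^ m`. -/
theorem setLIntegral_maxRegion {m : ℕ} (p : Fin (m + 1)) {f : (Fin (m + 1) → ℝ) → ENNReal}
    (hf : Measurable f) :
    ∫⁻ u in maxRegion p, f u = ∫⁻ s in Set.Ioo (0 : ℝ) 1,
      ENNReal.ofReal (s ^ m) * ∫⁻ v in unitCube m, f (p.insertNth s (s • v)) := by
  have hmp := (volume_preserving_piFinSuccAbove (fun _ : Fin (m + 1) => ℝ) p).symm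
  have hins : Measurable fun q : ℝ × (Fin m → ℝ) =>
      (p.insertNth q.1 q.2 : Fin (m + 1) → ℝ) :=
    (MeasurableEquiv.piFinSuccAbove (fun _ : Fin (m + 1) => ℝ) p).symm.measurable
  rw [← hmp.setLIntegral_comp_preimage_emb (MeasurableEquiv.measurableEmbedding _)]
  have hset : MeasurableSet
      ((MeasurableEquiv.piFinSuccAbove (fun _ : Fin (m + 1) => ℝ) p).symm ⁻¹' maxRegion p) :=
    MeasurableEquiv.measurable _ (measurableSet_maxRegion p)
  rw [← lintegral_indicator hset, Measure.volume_eq_prod]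
  refine (lintegral_prod _ ((hf.comp hins).indicator hset).aemeasurable).trans ?_
  rw [← lintegral_indicator measurableSet_Ioo]
  refine lintegral_congr fun s => ?_
  by_cases hs : s ∈ Set.Ioo (0 : ℝ) 1
  · rw [Set.indicator_of_mem hs, ← setLIntegral_cube_scale hs.1
      (g := fun v => f (p.insertNth s v)) (hf.comp (hins.comp measurable_prodMk_left)),
      ← lintegral_indicator (MeasurableSet.univ_pi fun _ => measurableSet_Ioo)]
    refine lintegral_congr fun v => ?_
    by_cases hv : v ∈ Set.univ.pi fun _ : Fin m => Set.Ioo 0 s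
    · rw [Set.indicator_of_mem hv, Set.indicator_of_mem]
      · rfl
      · simpa [maxRegion] using And.intro hs fun j => hv j trivial
    · rw [Set.indicator_of_notMem hv, Set.indicator_of_notMem]
      intro h
      refine hv fun j _ => ?_
      simpa using h.2 j
  · rw [Set.indicator_of_notMem hs]
    refine lintegral_eq_zero_of_ae_eq_zero (Filter.Eventually.of_forall fun v => ?_)
    refine Set.indicator_of_notMem (fun h => hs ?_) _
    simpa using h.1

theorem setLIntegral_unitCube_succ {m : ℕ} {f : (Fin (m + 1) → ℝ) → ENNReal}
    (hf : Measurable f) :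
    ∫⁻ u in unitCube (m + 1), f u = ∑ p : Fin (m + 1), ∫⁻ s in Set.Ioo (0 : ℝ) 1,
      ENNReal.ofReal (s ^ m) * ∫⁻ v in unitCube m, f (p.insertNth s (s • v)) := by
  rw [setLIntegral_congr (unitCube_ae_eq_iUnion_maxRegion m),
    lintegral_iUnion measurableSet_maxRegion pairwise_disjoint_maxRegion, tsum_fintype]
  exact Finset.sum_congr rfl fun p _ => setLIntegral_maxRegion p hf

/-- Read off from the total mass `1` of the beta density with parameters `a + 1`, `b + 1`. -/
theorem setLIntegral_pow_mul_one_sub_pow (a b : ℕ) :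
    ∫⁻ s in Set.Ioo (0 : ℝ) 1, ENNReal.ofReal s ^ a * ENNReal.ofReal (1 - s) ^ b =
      ENNReal.ofReal (a.factorial * b.factorial / (a + b + 1).factorial) := by
  have ha : (0 : ℝ) < a + 1 := by positivity
  have hb : (0 : ℝ) < b + 1 := by positivity
  have hbeta : beta (a + 1) (b + 1) = a.factorial * b.factorial / (a + b + 1).factorial := by
    rw [beta, Real.Gamma_nat_eq_factorial, Real.Gamma_nat_eq_factorial,
      show (a + 1 + (b + 1) : ℝ) = ((a + b + 1 : ℕ) : ℝ) + 1 by push_cast; ring,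
      Real.Gamma_nat_eq_factorial]
  have h := lintegral_betaPDF_eq_one ha hb
  rw [lintegral_betaPDF] at h
  have h2 : ∀ s ∈ Set.Ioo (0 : ℝ) 1, ENNReal.ofReal s ^ a * ENNReal.ofReal (1 - s) ^ b =
      ENNReal.ofReal (beta (a + 1) (b + 1)) * ENNReal.ofReal
        (1 / beta (a + 1) (b + 1) * s ^ ((a + 1 : ℝ) - 1) * (1 - s) ^ ((b + 1 : ℝ) - 1)) := by
    intro s hs
    have hpos := beta_pos ha hb
    have hs0 : 0 ≤ s := hs.1.le
    have hs1 : 0 ≤ 1 - s := by linarith [hs.2]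
    rw [← ENNReal.ofReal_mul hpos.le, ← ENNReal.ofReal_pow hs0, ← ENNReal.ofReal_pow hs1,
      ← ENNReal.ofReal_mul (by positivity), add_sub_cancel_right, add_sub_cancel_right,
      Real.rpow_natCast, Real.rpow_natCast]
    congr 1
    field_simp
  rw [setLIntegral_congr_fun measurableSet_Ioo h2,
    lintegral_const_mul' _ _ ENNReal.ofReal_ne_top, h, mul_one, hbeta]

/-! ### Moments of the average for fixed values -/

/-- The complete homogeneous symmetric polynomial of degree `k`, evaluated at `x`. -/
noncomputable def completeHomogeneous {R : Type*} [CommSemiring R] {n : ℕ} (x : Fin n → R)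
    (k : ℕ) : R :=
  PowerSeries.coeff k (∏ i, PowerSeries.mk fun j => x i ^ j)

theorem completeHomogeneous_one {R : Type*} [CommSemiring R] (x : Fin 1 → R) (k : ℕ) :
    completeHomogeneous x k = x 0 ^ k := by
  simp [completeHomogeneous]

/-- Splitting off the last geometric series gives the convolution that the binomial expansion around
the last spacing will match. -/
theorem completeHomogeneous_succ {R : Type*} [CommSemiring R] {n : ℕ} (x : Fin (n + 1) → R)
    (k : ℕ) :
    completeHomogeneous x k = ∑ ij ∈ Finset.HasAntidiagonal.antidiagonal k,
      completeHomogeneous (fun i => x (Fin.castSucc i)) ij.1 * x (Fin.last n) ^ ij.2 := by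
  simp [completeHomogeneous, Fin.prod_univ_castSucc, PowerSeries.coeff_mul]

theorem measurable_completeHomogeneous {n : ℕ} (k : ℕ) :
    Measurable fun x : Fin n → ENNReal => completeHomogeneous x k := by
  induction n generalizing k with
  | zero => simp only [completeHomogeneous, Finset.univ_eq_empty, Finset.prod_empty]; fun_prop
  | succ n ih =>
    simp only [completeHomogeneous_succ]
    refine Finset.measurable_fun_sum _ fun ij _ => Measurable.mul ?_ (by fun_prop)
    exact (ih ij.1).comp (by fun_prop)

/-- Given the maximum `s`, the average is `s A + (1 - s) x_last`, with `A` an average of the same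
kind over one sample point fewer. The binomial theorem, the induction hypothesis for `A` and a beta
integral in `s` reproduce the recursion `completeHomogeneous_succ`. -/
theorem setLIntegral_spacingAverage_pow {m : ℕ} (k : ℕ) {x : Fin (m + 1) → ℝ}
    (hx : ∀ i, 0 ≤ x i) :
    ∫⁻ u in unitCube m, ENNReal.ofReal (spacingAverage u x) ^ k =
      ENNReal.ofReal (k.factorial * m.factorial / (m + k).factorial) *
        completeHomogeneous (fun i => ENNReal.ofReal (x i)) k := by
  induction m generalizing k with
  | zero =>
    have hu : ∀ u : Fin 0 → ℝ, spacingAverage u x = x 0 := fun u => by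
      have h := orderStatistic_last u
      rw [zero_add] at h
      simp [spacingAverage, h, orderStatistic_zero]
    have hvol : volume (unitCube 0) = 1 := by
      simp [unitCube, volume_pi]
    simp [hu, completeHomogeneous_one, hvol, Nat.factorial_ne_zero]
  | succ m ih =>
    have hmeas : ∀ {n : ℕ} (y : Fin (n + 1) → ℝ) (k : ℕ),
        Measurable fun u : Fin n → ℝ => ENNReal.ofReal (spacingAverage u y) ^ k := fun y k =>
      (measurable_spacingAverage.comp (measurable_prodMk_right (y := y))).ennreal_ofReal.pow_const k
    have hx' : ∀ i : Fin (m + 1), 0 ≤ x i.castSucc := fun i => hx _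
    set X := ENNReal.ofReal (x (Fin.last (m + 1))) with hX
    set h := completeHomogeneous (fun i : Fin (m + 1) => ENNReal.ofReal (x i.castSucc)) with hh
    have hinner : ∀ p : Fin (m + 1), ∀ s ∈ Set.Ioo (0 : ℝ) 1,
        ENNReal.ofReal (s ^ m) * ∫⁻ v in unitCube m,
          ENNReal.ofReal (spacingAverage (p.insertNth s (s • v) : Fin (m + 1) → ℝ) x) ^ k =
        ∑ ij ∈ Finset.HasAntidiagonal.antidiagonal k,
          (k.choose ij.1 * ENNReal.ofReal (ij.1.factorial * m.factorial / (m + ij.1).factorial) *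
            (h ij.1 * X ^ ij.2)) *
          (ENNReal.ofReal s ^ (m + ij.1) * ENNReal.ofReal (1 - s) ^ ij.2) := by
      intro p s hs
      have hs0 : 0 ≤ s := hs.1.le
      have hs1 : 0 ≤ 1 - s := by linarith [hs.2]
      have hexp : ∀ v ∈ unitCube m,
          ENNReal.ofReal (spacingAverage (p.insertNth s (s • v) : Fin (m + 1) → ℝ) x) ^ k =
          ∑ ij ∈ Finset.HasAntidiagonal.antidiagonal k,
            (k.choose ij.1 * ENNReal.ofReal s ^ ij.1 * (ENNReal.ofReal (1 - s) * X) ^ ij.2) *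
              ENNReal.ofReal (spacingAverage v fun i => x i.castSucc) ^ ij.1 := by
        intro v hv
        have hw := spacingAverage_nonneg (fun j => (hv j trivial).1.le)
          (fun j => (hv j trivial).2.le) hx'
        rw [spacingAverage_insertNth_smul p hs0 (fun j => (hv j trivial).2.le),
          ENNReal.ofReal_add (by positivity) (mul_nonneg hs1 (hx _)), ENNReal.ofReal_mul hs0,
          ENNReal.ofReal_mul hs1, (Commute.all _ _).add_pow']
        refine Finset.sum_congr rfl fun ij _ => ?_
        rw [nsmul_eq_mul, mul_pow, ← hX]
        ring
      rw [setLIntegral_congr_fun (measurableSet_unitCube m) hexp,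
        lintegral_finsetSum _ fun ij _ => (hmeas _ _).const_mul _, Finset.mul_sum]
      refine Finset.sum_congr rfl fun ij _ => ?_
      rw [lintegral_const_mul _ (hmeas _ _), ih ij.1 hx', ENNReal.ofReal_pow hs0]
      ring
    rw [setLIntegral_unitCube_succ (hmeas x k)]
    simp_rw [setLIntegral_congr_fun measurableSet_Ioo (hinner _)]
    -- The integrand no longer depends on `p`, so the `m + 1` possible positions of the maximum
    -- contribute equally.
    rw [Finset.sum_const, Finset.card_univ, Fintype.card_fin, nsmul_eq_mul,
      lintegral_finsetSum _ fun ij _ => by fun_prop, completeHomogeneous_succ, Finset.mul_sum,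
      Finset.mul_sum]
    refine Finset.sum_congr rfl fun ij hij => ?_
    rw [lintegral_const_mul _ (by fun_prop), setLIntegral_pow_mul_one_sub_pow, ← hX]
    obtain ⟨i, j⟩ := ij
    obtain rfl : i + j = k := by simpa using hij
    -- Positions of the maximum, binomial coefficient, induction hypothesis and beta integral
    -- multiply to a constant that depends on `i` and `j` only through `i + j`.
    have hc : ((m + 1 : ℕ) : ENNReal) * ((i + j).choose i *
        ENNReal.ofReal (i.factorial * m.factorial / (m + i).factorial) *
        ENNReal.ofReal ((m + i).factorial * j.factorial / (m + i + j + 1).factorial)) =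
        ENNReal.ofReal ((i + j).factorial * (m + 1).factorial / (m + 1 + (i + j)).factorial) := by
      rw [← ENNReal.ofReal_natCast, ← ENNReal.ofReal_natCast,
        ← ENNReal.ofReal_mul (by positivity), ← ENNReal.ofReal_mul (by positivity),
        ← ENNReal.ofReal_mul (by positivity)]
      congr 1
      rw [Nat.choose_symm_add, ← Nat.add_choose_mul_factorial_mul_factorial i j,
        show m + 1 + (i + j) = m + i + j + 1 by ring, Nat.factorial_succ m]
      have h1 : ((m + i).factorial : ℝ) ≠ 0 := by positivity
      have h2 : ((m + i + j + 1).factorial : ℝ) ≠ 0 := by positivity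
      field_simp
      push_cast
      ring
    rw [← hc]
    simp only [hh]
    ring

/-! ### Negative binomial series and independence -/

theorem choose_neg_eq_neg_one_pow_mul_multichoose (r : ℝ) (k : ℕ) :
    Ring.choose (-r) k = (-1) ^ k * Ring.multichoose r k := by
  rw [Ring.choose_neg', Int.negOnePow_def, Units.smul_def, zsmul_eq_mul]
  simp

/-- The Chu-Vandermonde identity for `Ring.multichoose`. -/
theorem multichoose_add (r s : ℝ) (k : ℕ) :
    Ring.multichoose (r + s) k = ∑ ij ∈ Finset.HasAntidiagonal.antidiagonal k,
      Ring.multichoose r ij.1 * Ring.multichoose s ij.2 := by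
  have h := Ring.add_choose_eq k (Commute.all (-r) (-s))
  rw [← neg_add] at h
  simp only [choose_neg_eq_neg_one_pow_mul_multichoose] at h
  have hk : (-1 : ℝ) ^ k * (-1) ^ k = 1 := by rw [← mul_pow]; simp
  calc Ring.multichoose (r + s) k
      = (-1) ^ k * ((-1) ^ k * Ring.multichoose (r + s) k) := by rw [← mul_assoc, hk, one_mul]
    _ = _ := by
      rw [h, Finset.mul_sum]
      refine Finset.sum_congr rfl fun ij hij => ?_
      obtain ⟨i, j⟩ := ij
      obtain rfl : i + j = k := by simpa using hij
      rw [pow_add] at hk ⊢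
      linear_combination (Ring.multichoose r i * Ring.multichoose s j) * hk

theorem factorial_mul_multichoose (r : ℝ) (k : ℕ) :
    k.factorial * Ring.multichoose r k = (ascPochhammer ℝ k).eval r := by
  rw [← nsmul_eq_mul, Ring.factorial_nsmul_multichoose_eq_ascPochhammer,
    Polynomial.ascPochhammer_smeval_eq_eval]

theorem multichoose_nonneg {r : ℝ} (hr : 0 ≤ r) (k : ℕ) : 0 ≤ Ring.multichoose r k := by
  have h : 0 ≤ (ascPochhammer ℝ k).eval r := by
    induction k with
    | zero => simp
    | succ k ih => rw [ascPochhammer_succ_eval]; positivity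
  rw [← factorial_mul_multichoose] at h
  exact nonneg_of_mul_nonneg_right h (by positivity)

/-- Iterating `Γ(r + 1) = r Γ(r)` produces the rising factorial of `r`, which is `k!` times
`Ring.multichoose r k`. -/
theorem Gamma_add_natCast {r : ℝ} (hr : 0 < r) (k : ℕ) :
    Real.Gamma (r + k) = k.factorial * Ring.multichoose r k * Real.Gamma r := by
  rw [factorial_mul_multichoose]
  induction k with
  | zero => simp
  | succ k ih =>
    rw [Nat.cast_succ, ← add_assoc, Real.Gamma_add_one (by positivity), ih,
      ascPochhammer_succ_eval]
    ring

/-- The series is `(1 - c z)^(-a)`, whose `n`-th power is `(1 - c z)^(-n a)`; Chu-Vandermonde is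
this law of exponents on coefficients. The signs of `a` and `c` let `ENNReal.ofReal` pass through
sums and products. -/
theorem coeff_pow_mk_multichoose {a c : ℝ} (ha : 0 ≤ a) (hc : 0 ≤ c) (n k : ℕ) :
    PowerSeries.coeff k
      ((PowerSeries.mk fun j => ENNReal.ofReal (c ^ j * Ring.multichoose a j)) ^ n) =
    ENNReal.ofReal (c ^ k * Ring.multichoose (n * a) k) := by
  induction n generalizing k with
  | zero =>
    cases k <;> simp [PowerSeries.coeff_one, Ring.multichoose_zero_succ]
  | succ n ih =>
    have hmc := fun r (hr : 0 ≤ r) k => multichoose_nonneg (r := r) hr k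
    rw [pow_succ, PowerSeries.coeff_mul, Nat.cast_succ, add_mul, one_mul, multichoose_add,
      Finset.mul_sum, ENNReal.ofReal_sum_of_nonneg]
    · refine Finset.sum_congr rfl fun ij hij => ?_
      obtain ⟨i, j⟩ := ij
      obtain rfl : i + j = k := by simpa using hij
      rw [ih, PowerSeries.coeff_mk, ← ENNReal.ofReal_mul]
      · congr 1
        ring
      · exact mul_nonneg (by positivity) (hmc _ (by positivity) _)
    · intro ij _
      exact mul_nonneg (by positivity)
        (mul_nonneg (hmc _ (by positivity) _) (hmc _ ha _))

/-- The generating series of `completeHomogeneous` is a product of one factor per coordinate, so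
under a product measure its expectation is the product of the expected factors. -/
theorem lintegral_completeHomogeneous {ν : Measure ℝ} [IsProbabilityMeasure ν] {f : ℝ → ENNReal}
    (hf : Measurable f) (n k : ℕ) :
    ∫⁻ x, completeHomogeneous (fun i => f (x i)) k ∂(Measure.pi fun _ : Fin n => ν) =
      PowerSeries.coeff k ((PowerSeries.mk fun j => ∫⁻ y, f y ^ j ∂ν) ^ n) := by
  induction n generalizing k with
  | zero => simp [completeHomogeneous]
  | succ n ih =>
    have hmp := (measurePreserving_piFinSuccAbove (fun _ : Fin (n + 1) => ν) (Fin.last n)).symm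
    have hm : ∀ i, Measurable fun x : Fin n → ℝ => completeHomogeneous (fun j => f (x j)) i :=
      fun i => (measurable_completeHomogeneous i).comp (by fun_prop)
    have hsplit : ∀ q : ℝ × (Fin n → ℝ), completeHomogeneous (fun i => f
        ((MeasurableEquiv.piFinSuccAbove (fun _ : Fin (n + 1) => ℝ) (Fin.last n)).symm q i)) k =
        ∑ ij ∈ Finset.HasAntidiagonal.antidiagonal k,
          f q.1 ^ ij.2 * completeHomogeneous (fun j => f (q.2 j)) ij.1 := by
      intro q
      rw [completeHomogeneous_succ]
      refine Finset.sum_congr rfl fun ij _ => ?_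
      rw [mul_comm]
      simp [MeasurableEquiv.piFinSuccAbove, Fin.insertNthEquiv]
    rw [← hmp.lintegral_comp_emb (MeasurableEquiv.measurableEmbedding _)]
    simp_rw [hsplit]
    rw [lintegral_finsetSum _ fun ij _ => by
      exact ((hf.comp measurable_fst).pow_const _).mul ((hm _).comp measurable_snd),
      pow_succ, PowerSeries.coeff_mul]
    refine Finset.sum_congr rfl fun ij _ => ?_
    rw [lintegral_prod_mul (hf.pow_const _).aemeasurable (hm _).aemeasurable, ih,
      PowerSeries.coeff_mk, mul_comm]

/-! ### Beta laws and their moments -/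

theorem betaDensityOn_eq {p q a b : ℝ} (hab : a < b) (x : ℝ) :
    betaDensityOn p q a b x = (b - a)⁻¹ * betaPDFReal p q ((b - a)⁻¹ * (x - a)) := by
  have hpos : 0 < b - a := sub_pos.2 hab
  have hiff : (0 < (b - a)⁻¹ * (x - a) ∧ (b - a)⁻¹ * (x - a) < 1) ↔ a < x ∧ x < b := by
    rw [mul_pos_iff_of_pos_left (inv_pos.2 hpos), inv_mul_lt_iff₀ hpos, mul_one, sub_pos,
      sub_lt_sub_iff_right]
  unfold betaDensityOn betaPDFReal
  by_cases h : a < x ∧ x < b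
  · rw [if_pos h, if_pos (hiff.2 h), show 1 - (b - a)⁻¹ * (x - a) = (b - a)⁻¹ * (b - x) by
      field_simp; ring, Real.mul_rpow (by positivity) (by linarith),
      Real.mul_rpow (by positivity) (by linarith), Real.inv_rpow hpos.le, Real.inv_rpow hpos.le,
      show p + q - 1 = 1 + (p - 1) + (q - 1) by ring, Real.rpow_add hpos, Real.rpow_add hpos,
      Real.rpow_one]
    simp only [one_div, mul_inv]
    ring
  · rw [if_neg h, if_neg (mt hiff.1 h), mul_zero]

theorem measurable_betaDensityOn (p q a b : ℝ) : Measurable (betaDensityOn p q a b) :=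
  Measurable.ite measurableSet_Ioo (by fun_prop) (by fun_prop)

theorem lintegral_betaDensityOn {p q a b : ℝ} (hp : 0 < p) (hq : 0 < q) (hab : a < b) :
    ∫⁻ x, ENNReal.ofReal (betaDensityOn p q a b x) = 1 := by
  have hpos : 0 < b - a := sub_pos.2 hab
  have hm : Measurable (betaPDF p q) := (measurable_betaPDFReal p q).ennreal_ofReal
  simp_rw [betaDensityOn_eq hab, ENNReal.ofReal_mul (inv_nonneg.2 hpos.le)]
  rw [lintegral_const_mul _ (by fun_prop), lintegral_sub_right_eq_self
    (fun x => ENNReal.ofReal (betaPDFReal p q ((b - a)⁻¹ * x))) a]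
  change _ * ∫⁻ x, betaPDF p q ((b - a)⁻¹ * x) = 1
  rw [← lintegral_map hm (measurable_const_mul _), Real.map_volume_mul_left (inv_pos.2 hpos).ne',
    lintegral_smul_measure, lintegral_betaPDF_eq_one hp hq, inv_inv, abs_of_pos hpos, smul_eq_mul,
    mul_one, ← ENNReal.ofReal_mul (inv_nonneg.2 hpos.le), inv_mul_cancel₀ hpos.ne',
    ENNReal.ofReal_one]

theorem isProbabilityMeasure_betaLawOn {p q a b : ℝ} (hp : 0 < p) (hq : 0 < q) (hab : a < b) :
    IsProbabilityMeasure (betaLawOn p q a b) :=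
  ⟨by rw [betaLawOn, withDensity_apply _ MeasurableSet.univ, setLIntegral_univ,
    lintegral_betaDensityOn hp hq hab]⟩

theorem ae_mem_Ioo_betaLawOn (p q a b : ℝ) : ∀ᵐ x ∂betaLawOn p q a b, x ∈ Set.Ioo a b := by
  rw [betaLawOn, ae_withDensity_iff (measurable_betaDensityOn p q a b).ennreal_ofReal]
  refine Filter.Eventually.of_forall fun x hx => ?_
  by_contra h
  exact hx (by rw [betaDensityOn, if_neg (show ¬(a < x ∧ x < b) from h), ENNReal.ofReal_zero])

/-- Multiplying the density by `(x - a) ^ k` gives a constant multiple of the density with `p`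
replaced by `p + k`, which has mass `1`. -/
theorem lintegral_pow_betaLawOn {p q a b : ℝ} (hp : 0 < p) (hq : 0 < q) (hab : a < b) (k : ℕ) :
    ∫⁻ x, ENNReal.ofReal (x - a) ^ k ∂betaLawOn p q a b =
      ENNReal.ofReal ((b - a) ^ k * (beta (p + k) q / beta p q)) := by
  have hpos : 0 < b - a := sub_pos.2 hab
  have hk : 0 < p + k := by positivity
  have hb := beta_pos hp hq
  have hb' := beta_pos hk hq
  have hd := (measurable_betaDensityOn p q a b).ennreal_ofReal
  have hd' := (measurable_betaDensityOn (p + k) q a b).ennreal_ofReal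
  rw [betaLawOn, lintegral_withDensity_eq_lintegral_mul _ hd (by fun_prop)]
  have hx : ∀ x, ENNReal.ofReal (betaDensityOn p q a b x) * ENNReal.ofReal (x - a) ^ k =
      ENNReal.ofReal ((b - a) ^ k * (beta (p + k) q / beta p q)) *
        ENNReal.ofReal (betaDensityOn (p + k) q a b x) := by
    intro x
    unfold betaDensityOn
    by_cases h : a < x ∧ x < b
    · have hxa : 0 < x - a := sub_pos.2 h.1
      have hbx : 0 < b - x := sub_pos.2 h.2
      rw [if_pos h, if_pos h, ← ENNReal.ofReal_pow hxa.le, ← ENNReal.ofReal_mul (by positivity),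
        ← ENNReal.ofReal_mul (by positivity), show p + k - 1 = p - 1 + k by ring,
        show p + k + q - 1 = p + q - 1 + k by ring, Real.rpow_add hxa, Real.rpow_add hpos,
        Real.rpow_natCast, Real.rpow_natCast]
      congr 1
      field_simp
    · rw [if_neg h, if_neg h]
      simp
  simp_rw [Pi.mul_apply, hx]
  rw [lintegral_const_mul _ hd', lintegral_betaDensityOn hk hq hab, mul_one]

/-- The condition on `p` turns `Γ(2p)` and `Γ(2p + k)` into `m!` and `(m + k)!`. This yields exactly
the factor found for the spacings; for the arcsine law, where `m = 0`, it is `1`. -/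
theorem beta_div_beta {p : ℝ} (hp : 0 < p) {m : ℕ} (hm : p + p = m + 1) (k : ℕ) :
    beta (p + k) p / beta p p =
      k.factorial * m.factorial / (m + k).factorial * Ring.multichoose p k := by
  have hG := Real.Gamma_pos_of_pos hp
  rw [beta, beta, Gamma_add_natCast hp, show p + k + p = ((m + k : ℕ) : ℝ) + 1 by
    push_cast; linarith, hm, Real.Gamma_nat_eq_factorial, Real.Gamma_nat_eq_factorial]
  field_simp

/-! ### Determination by moments on a compact interval -/

theorem integrable_of_continuous_of_ae_mem_Icc {μ : Measure ℝ} [IsFiniteMeasure μ] {a b : ℝ}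
    (hμ : ∀ᵐ x ∂μ, x ∈ Set.Icc a b) {f : ℝ → ℝ} (hf : Continuous f) : Integrable f μ := by
  obtain ⟨C, hC⟩ := isCompact_Icc.exists_bound_of_continuousOn (s := Set.Icc a b) hf.continuousOn
  exact Integrable.of_bound hf.aestronglyMeasurable C (hμ.mono fun x hx => hC x hx)

theorem integral_polynomial_eq {μ ν : Measure ℝ} [IsFiniteMeasure μ] [IsFiniteMeasure ν] {a b : ℝ}
    (hμ : ∀ᵐ x ∂μ, x ∈ Set.Icc a b) (hν : ∀ᵐ x ∂ν, x ∈ Set.Icc a b)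
    (h : ∀ k : ℕ, ∫⁻ x, ENNReal.ofReal (x - a) ^ k ∂μ = ∫⁻ x, ENNReal.ofReal (x - a) ^ k ∂ν)
    (p : Polynomial ℝ) : ∫ x, p.eval (x - a) ∂μ = ∫ x, p.eval (x - a) ∂ν := by
  have hmom : ∀ {ρ : Measure ℝ}, (∀ᵐ x ∂ρ, x ∈ Set.Icc a b) → ∀ k : ℕ,
      ∫ x, (x - a) ^ k ∂ρ = (∫⁻ x, ENNReal.ofReal (x - a) ^ k ∂ρ).toReal := by
    intro ρ hρ k
    rw [integral_eq_lintegral_of_nonneg_ae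
      (hρ.mono fun x hx => pow_nonneg (sub_nonneg.2 hx.1) k)
      (Continuous.aestronglyMeasurable (by fun_prop))]
    congr 1
    exact lintegral_congr_ae
      (hρ.mono fun x hx => ENNReal.ofReal_pow (sub_nonneg.2 hx.1) k)
  simp_rw [Polynomial.eval_eq_sum_range]
  rw [integral_finsetSum _ fun i _ => integrable_of_continuous_of_ae_mem_Icc hμ (by fun_prop),
    integral_finsetSum _ fun i _ => integrable_of_continuous_of_ae_mem_Icc hν (by fun_prop)]
  refine Finset.sum_congr rfl fun i _ => ?_
  rw [integral_const_mul, integral_const_mul, hmom hμ, hmom hν, h]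

/-- Finite measures carried by a compact interval are determined by their moments. -/
theorem ext_of_lintegral_pow_eq {μ ν : Measure ℝ} [IsFiniteMeasure μ] [IsFiniteMeasure ν] {a b : ℝ}
    (hμ : ∀ᵐ x ∂μ, x ∈ Set.Icc a b) (hν : ∀ᵐ x ∂ν, x ∈ Set.Icc a b)
    (h : ∀ k : ℕ, ∫⁻ x, ENNReal.ofReal (x - a) ^ k ∂μ = ∫⁻ x, ENNReal.ofReal (x - a) ^ k ∂ν) :
    μ = ν := by
  refine ext_of_forall_integral_eq_of_IsFiniteMeasure fun f => ?_
  have hbound : ∀ ε > 0, |∫ x, f x ∂μ - ∫ x, f x ∂ν| ≤ (μ.real Set.univ + ν.real Set.univ) * ε := by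
    intro ε hε
    -- Weierstrass approximation, applied to the translate of `f` on `[0, b - a]` because the
    -- moments are taken about `a`.
    obtain ⟨p, hp⟩ := exists_polynomial_near_of_continuousOn 0 (b - a) (fun y => f (y + a))
      (by fun_prop) ε hε
    have hdiff : ∀ {ρ : Measure ℝ} [IsFiniteMeasure ρ], (∀ᵐ x ∂ρ, x ∈ Set.Icc a b) →
        |∫ x, f x ∂ρ - ∫ x, p.eval (x - a) ∂ρ| ≤ ε * ρ.real Set.univ := by
      intro ρ _ hρ
      have hpc : Continuous fun x => p.eval (x - a) := by fun_prop
      rw [← integral_sub (integrable_of_continuous_of_ae_mem_Icc hρ f.continuous)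
        (integrable_of_continuous_of_ae_mem_Icc hρ hpc), ← Real.norm_eq_abs]
      refine norm_integral_le_of_norm_le_const (hρ.mono fun x hx => ?_)
      have := hp (x - a) ⟨sub_nonneg.2 hx.1, sub_le_sub_right hx.2 a⟩
      rw [sub_add_cancel, abs_sub_comm] at this
      exact this.le
    have h1 := hdiff hμ
    have h2 := hdiff hν
    rw [← integral_polynomial_eq hμ hν h p, abs_sub_comm] at h2
    calc |∫ x, f x ∂μ - ∫ x, f x ∂ν| ≤ _ := abs_sub_le _ (∫ x, p.eval (x - a) ∂μ) _
      _ ≤ ε * μ.real Set.univ + ε * ν.real Set.univ := add_le_add h1 h2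
      _ = _ := by ring
  have hlim : Filter.Tendsto (fun ε : ℝ => (μ.real Set.univ + ν.real Set.univ) * ε)
      (nhdsWithin 0 (Set.Ioi 0)) (nhds 0) := by
    have : Continuous fun ε : ℝ => (μ.real Set.univ + ν.real Set.univ) * ε := by fun_prop
    simpa using (this.tendsto 0).mono_left nhdsWithin_le_nhds
  have h0 := ge_of_tendsto hlim (eventually_nhdsWithin_of_forall fun ε hε => hbound ε hε)
  exact sub_eq_zero.1 (abs_nonpos_iff.1 h0)

/-! ### Arcsine and power semicircle laws -/

theorem powerSemicircle_eq_betaLawOn (m : ℕ) (σ : ℝ) :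
    powerSemicircle (((m + 1 : ℕ) - 3) / 2) σ =
      betaLawOn ((m + 1) / 2) ((m + 1) / 2) (-σ) σ := by
  rw [powerSemicircle]
  congr 1 <;> push_cast <;> ring

theorem arcsineLaw_eq_betaLawOn (σ : ℝ) : arcsineLaw σ = betaLawOn (1 / 2) (1 / 2) (-σ) σ := by
  rw [arcsineLaw, powerSemicircle]
  congr 1 <;> norm_num

theorem isProbabilityMeasure_arcsineLaw {σ : ℝ} (hσ : 0 < σ) :
    IsProbabilityMeasure (arcsineLaw σ) := by
  rw [arcsineLaw_eq_betaLawOn]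
  exact isProbabilityMeasure_betaLawOn (by norm_num) (by norm_num) (by linarith)

theorem ae_mem_Ioo_arcsineLaw (σ : ℝ) : ∀ᵐ x ∂arcsineLaw σ, x ∈ Set.Ioo (-σ) σ := by
  rw [arcsineLaw_eq_betaLawOn]
  exact ae_mem_Ioo_betaLawOn _ _ _ _

theorem arcsineLaw_singleton (σ x : ℝ) : arcsineLaw σ {x} = 0 :=
  withDensity_absolutelyContinuous _ _ (measure_singleton x)

theorem lintegral_pow_powerSemicircle {σ : ℝ} (hσ : 0 < σ) (m k : ℕ) :
    ∫⁻ x, ENNReal.ofReal (x - -σ) ^ k ∂powerSemicircle (((m + 1 : ℕ) - 3) / 2) σ =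
      ENNReal.ofReal ((σ - -σ) ^ k * (k.factorial * m.factorial / (m + k).factorial *
        Ring.multichoose ((m + 1) / 2 : ℝ) k)) := by
  have hp : (0 : ℝ) < (m + 1) / 2 := by positivity
  rw [powerSemicircle_eq_betaLawOn, lintegral_pow_betaLawOn hp hp (by linarith),
    beta_div_beta hp (m := m) (by ring)]

theorem lintegral_pow_arcsineLaw {σ : ℝ} (hσ : 0 < σ) (k : ℕ) :
    ∫⁻ x, ENNReal.ofReal (x - -σ) ^ k ∂arcsineLaw σ =
      ENNReal.ofReal ((σ - -σ) ^ k * Ring.multichoose (1 / 2 : ℝ) k) := by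
  have hp : (0 : ℝ) < 1 / 2 := by norm_num
  rw [arcsineLaw_eq_betaLawOn, lintegral_pow_betaLawOn hp hp (by linarith),
    beta_div_beta hp (m := 0) (by norm_num)]
  simp [Nat.factorial_ne_zero]

/-! ### Law of the randomly weighted average -/

theorem restrict_Ioo_eq_cond :
    (volume : Measure ℝ).restrict (Set.Ioo 0 1) = cond volume (Set.Ioo 0 1) := by
  simp [ProbabilityTheory.cond]

instance : IsProbabilityMeasure ((volume : Measure ℝ).restrict (Set.Ioo 0 1)) :=
  ⟨by simp⟩

theorem restrict_unitCube_eq_pi (m : ℕ) :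
    (volume : Measure (Fin m → ℝ)).restrict (unitCube m) =
      Measure.pi fun _ => (volume : Measure ℝ).restrict (Set.Ioo 0 1) :=
  Measure.restrict_pi_pi _ _

theorem ae_pi_mem {ι : Type*} [Fintype ι] {ν : Measure ℝ} [IsProbabilityMeasure ν] {s : Set ℝ}
    (h : ∀ᵐ x ∂ν, x ∈ s) : ∀ᵐ x ∂(Measure.pi fun _ : ι => ν), ∀ i, x i ∈ s :=
  ae_all_iff.2 fun i => (measurePreserving_eval (fun _ : ι => ν) i).quasiMeasurePreserving.ae h

/-- The law of the average of an arcsine sample weighted by the spacings of a uniform sample. -/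
theorem map_spacingAverage_arcsineLaw {σ : ℝ} (hσ : 0 < σ) (m : ℕ) :
    (((volume : Measure (Fin m → ℝ)).restrict (unitCube m)).prod
      (Measure.pi fun _ : Fin (m + 1) => arcsineLaw σ)).map
        (fun q => spacingAverage q.1 q.2) = powerSemicircle (((m + 1 : ℕ) - 3) / 2) σ := by
  have := isProbabilityMeasure_arcsineLaw hσ
  have : IsProbabilityMeasure ((volume : Measure (Fin m → ℝ)).restrict (unitCube m)) := by
    rw [restrict_unitCube_eq_pi]; infer_instance
  have hp : (0 : ℝ) < (m + 1) / 2 := by positivity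
  have : IsProbabilityMeasure (powerSemicircle (((m + 1 : ℕ) - 3) / 2) σ) := by
    rw [powerSemicircle_eq_betaLawOn]
    exact isProbabilityMeasure_betaLawOn hp hp (by linarith)
  have hmeas := measurable_spacingAverage (m := m)
  have hx : ∀ᵐ x ∂(Measure.pi fun _ : Fin (m + 1) => arcsineLaw σ),
      ∀ i, x i ∈ Set.Ioo (-σ) σ := ae_pi_mem (ae_mem_Ioo_arcsineLaw σ)
  have hu : ∀ᵐ u ∂((volume : Measure (Fin m → ℝ)).restrict (unitCube m)), u ∈ unitCube m :=
    ae_restrict_mem (measurableSet_unitCube m)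
  refine ext_of_lintegral_pow_eq (a := -σ) (b := σ) ?_ ?_ fun k => ?_
  · refine (ae_map_iff hmeas.aemeasurable measurableSet_Icc).2 ?_
    filter_upwards [Measure.quasiMeasurePreserving_fst.ae hu,
      Measure.quasiMeasurePreserving_snd.ae hx] with q hq1 hq2
    exact spacingAverage_mem_Icc (fun j => (hq1 j trivial).1.le) (fun j => (hq1 j trivial).2.le)
      fun i => Set.Ioo_subset_Icc_self (hq2 i)
  · rw [powerSemicircle_eq_betaLawOn]
    exact (ae_mem_Ioo_betaLawOn _ _ _ _).mono fun x hx => Set.Ioo_subset_Icc_self hx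
  -- The uniform sample is integrated out first, for fixed `x`. The shift by `σ` moves from the
  -- average to each `x i`, making them nonnegative almost surely.
  · have hinner : ∀ᵐ x ∂(Measure.pi fun _ : Fin (m + 1) => arcsineLaw σ),
        ∫⁻ u in unitCube m, ENNReal.ofReal (spacingAverage u x - -σ) ^ k =
        ENNReal.ofReal (k.factorial * m.factorial / (m + k).factorial) *
          completeHomogeneous (fun i => ENNReal.ofReal (x i - -σ)) k := by
      filter_upwards [hx] with x hx
      rw [← setLIntegral_spacingAverage_pow k fun i => sub_nonneg.2 (hx i).1.le]
      refine lintegral_congr fun u => ?_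
      simp_rw [sub_eq_add_neg, spacingAverage_add_const]
    have hf : Measurable fun y : ℝ => ENNReal.ofReal (y - -σ) := by fun_prop
    rw [lintegral_map (by fun_prop) hmeas, lintegral_prod_symm _
      (((hmeas.sub_const _).ennreal_ofReal.pow_const _).aemeasurable), lintegral_congr_ae hinner,
      lintegral_const_mul' _ _ ENNReal.ofReal_ne_top,
      lintegral_completeHomogeneous hf, lintegral_pow_powerSemicircle hσ]
    simp_rw [lintegral_pow_arcsineLaw hσ]
    -- Used with `a = 1/2`, `c = 2σ` and exponent `m + 1`.
    rw [coeff_pow_mk_multichoose (by norm_num) (by linarith), ← ENNReal.ofReal_mul (by positivity),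
      show ((m + 1 : ℕ) * (1 / 2) : ℝ) = (m + 1) / 2 by push_cast; ring]
    congr 1
    ring

/-- Independence makes the joint law of `U` and `X` a product measure, and the law of the average
depends only on that joint law; the canonical computation therefore transfers to any probability
space. -/
theorem hasLaw_rwa_powerSemicircle {σ : ℝ} (hσ : 0 < σ) {m : ℕ} {Ω : Type*} [MeasurableSpace Ω]
    {P : Measure Ω} [IsProbabilityMeasure P] {U : Fin m → Ω → ℝ} {X : Fin (m + 1) → Ω → ℝ}
    (h : IsRWAData (n := m + 1) U X P) (hX : ∀ i, HasLaw (X i) (arcsineLaw σ) P) :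
    HasLaw (rwa (n := m + 1) U X) (powerSemicircle (((m + 1 : ℕ) - 3) / 2) σ) P := by
  have := isProbabilityMeasure_arcsineLaw hσ
  have hU : ∀ j, AEMeasurable (U j) P := fun j => (h.uniform j).aemeasurable (by simp) (by simp)
  have hUlaw : ∀ j, P.map (U j) = volume.restrict (Set.Ioo 0 1) := fun j =>
    (h.uniform j).trans restrict_Ioo_eq_cond.symm
  let ρ : Fin m ⊕ Fin (m + 1) → Measure ℝ :=
    Sum.elim (fun _ => volume.restrict (Set.Ioo 0 1)) fun _ => arcsineLaw σ
  have : ∀ i, IsProbabilityMeasure (ρ i) := by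
    rintro (i | i) <;> simp only [ρ, Sum.elim_inl, Sum.elim_inr] <;> infer_instance
  have hUX : ∀ i, AEMeasurable (Sum.elim U X i) P := by
    rintro (i | i)
    · exact hU i
    · exact (hX i).aemeasurable
  have hjoint : HasLaw (fun ω i => Sum.elim U X i ω) (Measure.pi ρ) P := by
    refine ⟨aemeasurable_pi_lambda _ hUX, ?_⟩
    rw [iIndepFun.map_fun_eq_pi_map hUX h.indep]
    congr 1
    ext1 i
    rcases i with i | i
    · exact hUlaw i
    · exact (hX i).map_eq
  have hsplit := (measurePreserving_sumPiEquivProdPi ρ).hasLaw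
  have hprod : HasLaw (fun q : (Fin m → ℝ) × (Fin (m + 1) → ℝ) => spacingAverage q.1 q.2)
      (powerSemicircle (((m + 1 : ℕ) - 3) / 2) σ)
      ((Measure.pi fun i => ρ (.inl i)).prod (Measure.pi fun i => ρ (.inr i))) := by
    refine ⟨measurable_spacingAverage.aemeasurable, ?_⟩
    rw [← map_spacingAverage_arcsineLaw hσ, restrict_unitCube_eq_pi]
    rfl
  exact (hprod.comp hsplit).comp hjoint

/-- The coordinate projections on a finite product of uniform and arcsine laws serve as witnesses.
-/
theorem exists_isRWAData_arcsineLaw {σ : ℝ} (hσ : 0 < σ) (m : ℕ) :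
    ∃ (Ω : Type) (_ : MeasurableSpace Ω) (P : Measure Ω) (U : Fin m → Ω → ℝ)
      (X : Fin (m + 1) → Ω → ℝ), IsProbabilityMeasure P ∧ IsRWAData (n := m + 1) U X P ∧
        ∀ i, HasLaw (X i) (arcsineLaw σ) P := by
  have := isProbabilityMeasure_arcsineLaw hσ
  let ρ : Fin m ⊕ Fin (m + 1) → Measure ℝ :=
    Sum.elim (fun _ => volume.restrict (Set.Ioo 0 1)) fun _ => arcsineLaw σ
  have : ∀ i, IsProbabilityMeasure (ρ i) := by
    rintro (i | i) <;> simp only [ρ, Sum.elim_inl, Sum.elim_inr] <;> infer_instance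
  have hlaw : ∀ i, HasLaw (fun ω : Fin m ⊕ Fin (m + 1) → ℝ => ω i) (ρ i) (Measure.pi ρ) :=
    fun i => (measurePreserving_eval ρ i).hasLaw
  refine ⟨Fin m ⊕ Fin (m + 1) → ℝ, inferInstance, Measure.pi ρ, fun j ω => ω (.inl j),
    fun i ω => ω (.inr i), inferInstance, ⟨fun j => ?_, fun i => ?_, fun i x => ?_, ?_⟩,
    fun i => hlaw (.inr i)⟩
  · exact (hlaw (.inl j)).map_eq.trans restrict_Ioo_eq_cond
  · exact (hlaw (.inr i)).aemeasurable
  · rw [(hlaw (.inr i)).map_eq]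
    exact arcsineLaw_singleton σ x
  · have hindep := iIndepFun_pi (μ := ρ) (X := fun _ x => x) fun i => aemeasurable_id
    have hsum : Sum.elim (fun (j : Fin m) (ω : Fin m ⊕ Fin (m + 1) → ℝ) => ω (.inl j))
        (fun i ω => ω (.inr i)) = fun i ω => ω i := by
      ext1 i
      rcases i with i | i <;> rfl
    exact hsum ▸ hindep

end RandomWeightedAverage

theorem corollary3p2 (n : ℕ) (hn : 2 ≤ n) (σ : ℝ) (hσ : 0 < σ) :
    (∃ (Ω : Type) (_ : MeasurableSpace Ω) (P : Measure Ω)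
        (U : Fin (n - 1) → Ω → ℝ) (X : Fin n → Ω → ℝ),
      IsProbabilityMeasure P ∧
      RandomWeightedAverage.IsRWAData U X P ∧
      (∀ i, HasLaw (X i) (RandomWeightedAverage.arcsineLaw σ) P) ∧
      HasLaw (RandomWeightedAverage.rwa U X)
        (RandomWeightedAverage.powerSemicircle (((n : ℝ) - 3) / 2) σ) P) ∧
    (∀ (Ω : Type*) [MeasurableSpace Ω] (P : Measure Ω) [IsProbabilityMeasure P]
        (U : Fin (n - 1) → Ω → ℝ) (X : Fin n → Ω → ℝ),
      RandomWeightedAverage.IsRWAData U X P →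
      (∀ i, HasLaw (X i) (RandomWeightedAverage.arcsineLaw σ) P) →
      HasLaw (RandomWeightedAverage.rwa U X)
        (RandomWeightedAverage.powerSemicircle (((n : ℝ) - 3) / 2) σ) P) := by
  -- After this substitution `Fin (n - 1)` is definitionally `Fin m`.
  obtain ⟨m, rfl⟩ : ∃ m, n = m + 1 := ⟨n - 1, by omega⟩
  refine ⟨?_, fun Ω _ P _ U X h hX =>
    RandomWeightedAverage.hasLaw_rwa_powerSemicircle hσ h hX⟩
  obtain ⟨Ω, _, P, U, X, hP, h, hX⟩ :=
    RandomWeightedAverage.exists_isRWAData_arcsineLaw hσ m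
  exact ⟨Ω, _, P, U, X, hP, h, hX, RandomWeightedAverage.hasLaw_rwa_powerSemicircle hσ h hX⟩
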